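/- Let $E$ be a finite set and $(G,\mathcal G)$ a measurable space, let $f:E\times G\to E$ be measurable, and write $f_v(x)=f(x,v)$. Let $(V_n)_{n\in\mathbb Z}$ be i.i.d. $G$-valued random variables with law $\beta$, and let $(X_n)_{n\in\mathbb Z}$ be $E$-valued random variables on the same probability space such that, for every $n\in\mathbb Z$, $X_{n+1}=f(X_n,V_{n+1})$ almost surely and $V_{n+1}$ is independent of $((X_k,V_k))_{k\le n}$. Assume that the transition kernel $\Pi$, where $\Pi(x,\cdot)$ is the law of $f(x,V_1)$, is irreducible and aperiodic. Assume also hypothesis $\mathcal H$: there is a probability measure $\alpha$ on $G$ equivalent to $\beta$ such that $\int_G \operatorname{Card} f_v^{-1}\{y\}\,\alpha(dv)=1$ for every $y\in E$ (that is, the uniform law on $E$ is invariant for the chain whose innovations have law $\alpha$). Two states $x,y\in E$ are called accordable if for some integer $l\ge1$ one has $P[f_{V_l}\circ\dots\circ f_{V_1}(x)=f_{V_l}\circ\dots\circ f_{V_1}(y)]>0$. Let $M$ be the maximal number of pairwise non-accordable elements of $E$. Let $H=\{h\in E^E: P[f_{V_1}=h]>0\}$, and let $S$ be the semigroup generated by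 $H$ under composition. The elements of a set $A\subset E$ are called simultaneously accordable if some $s\in S$ is constant on $A$. Let $N$ be the maximal number of simultaneously accordable elements of $E$. One says that $s\in S$ realizes a maximal accord if $s(E)$ consists of exactly $M$ points which are pairwise non-accordable. For a process $Y$ let $\mathcal F_n^Y$ be the $\sigma$-algebra generated by $(Y_k)_{k\le n}$, completed by the null sets. Then: 1. If $s\in S$ realizes a maximal accord, then for every $y\in s(E)$ the fibre $s^{-1}\{y\}$ has exactly $N$ elements, and these are simultaneously accordable. 2. $MN=\operatorname{Card}E$. 3. If $\operatorname{Card}E$ is prime, exactly one of the following two cases holds: - every element of $H$ is a bijection of $E$ onto $E$, and for every $n\in\mathbb Z$ the variable $X_n$ is uniformly distributed on $E$ and independent of the sequence $V=(V_k)_{k\in\mathbb Z}$; - all the elements of $E$ are simultaneously accordable, and $\mathcal F_n^X\subset\mathcal F_n^V$ for every $n\in\mathbb Z$. -/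

import Mathlib

open MeasureTheory ProbabilityTheory
open scoped ENNReal

noncomputable section

namespace RecursiveChain

variable {Ω E G : Type*} [MeasurableSpace Ω] [MeasurableSpace E] [MeasurableSpace G]

/-- `X` is a recursive (constructive) Markov chain indexed by `ℤ`, governed by the map `f` and by
the i.i.d. innovations `V` with common law `β`: `X (n+1) = f (X n, V (n+1))`, where `V (n+1)` is
independent of the whole past `((X k, V k))`, `k ≤ n`. -/
structure IsRecursiveChain (μ : Measure Ω) (β : Measure G) (f : E × G → E)
    (X : ℤ → Ω → E) (V : ℤ → Ω → G) : Prop where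
  measurable_map : Measurable f
  measurable_state : ∀ n, Measurable (X n)
  measurable_innovation : ∀ n, Measurable (V n)
  law_innovation : ∀ n, μ.map (V n) = β
  indep_innovation : iIndepFun V μ
  indep_past : ∀ n : ℤ,
    IndepFun (V (n + 1)) (fun ω (k : Set.Iic n) => (X k ω, V k ω)) μ
  recursion : ∀ n : ℤ, ∀ᵐ ω ∂μ, X (n + 1) ω = f (X n ω, V (n + 1) ω)

/-- The transition matrix of the chain: row `x` is the law of `f (x, V 1)`. -/
def transitionMatrix (μ : Measure Ω) (f : E × G → E) (V : ℤ → Ω → G) : Matrix E E ℝ :=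
  Matrix.of fun x y => μ.real {ω | f (x, V 1 ω) = y}

/-- Every state has period one: the only common divisor of its possible return times is `1`. -/
def IsAperiodic [Fintype E] [DecidableEq E] (P : Matrix E E ℝ) : Prop :=
  ∀ x : E, ∀ d : ℕ, (∀ n : ℕ, 0 < n → 0 < (P ^ n) x x → d ∣ n) → d = 1

/-- The random map `f_{V_l} ∘ ⋯ ∘ f_{V_1}`, where `f_v x = f (x, v)`. -/
def flow (f : E × G → E) (V : ℤ → Ω → G) : ℕ → Ω → E → E
  | 0, _, x => x
  | l + 1, ω, x => f (flow f V l ω x, V ((l : ℤ) + 1) ω)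

/-- Two states `x`, `y` are accordable if, for some `l ≥ 1`, the map `f_{V_l} ∘ ⋯ ∘ f_{V_1}`
sends them to the same point with positive probability. -/
def Accordable (μ : Measure Ω) (f : E × G → E) (V : ℤ → Ω → G) (x y : E) : Prop :=
  ∃ l : ℕ, 1 ≤ l ∧ 0 < μ {ω | flow f V l ω x = flow f V l ω y}

/-- The elements of `A` are pairwise non accordable. -/
def PairwiseNonaccordable (μ : Measure Ω) (f : E × G → E) (V : ℤ → Ω → G) (A : Set E) : Prop :=
  A.Pairwise fun x y => ¬ Accordable μ f V x y

/-- `M`: the maximal number of pairwise non accordable states. -/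
def maxNonaccordable (μ : Measure Ω) (f : E × G → E) (V : ℤ → Ω → G) : ℕ :=
  sSup {m | ∃ A : Set E, PairwiseNonaccordable μ f V A ∧ A.ncard = m}

/-- `H`: the set of maps `h : E → E` such that `f_{V_1} = h` with positive probability. -/
def essentialMaps (μ : Measure Ω) (f : E × G → E) (V : ℤ → Ω → G) : Set (Function.End E) :=
  {h | 0 < μ {ω | ∀ x, f (x, V 1 ω) = h x}}

/-- `S`: the semigroup (for composition) generated by `H`. -/
def mapSemigroup (μ : Measure Ω) (f : E × G → E) (V : ℤ → Ω → G) :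
    Subsemigroup (Function.End E) :=
  Subsemigroup.closure (essentialMaps μ f V)

/-- The elements of `A` are simultaneously accordable: some `s ∈ S` is constant on `A`. -/
def SimultaneouslyAccordable (μ : Measure Ω) (f : E × G → E) (V : ℤ → Ω → G)
    (A : Set E) : Prop :=
  ∃ s ∈ mapSemigroup μ f V, ∀ a ∈ A, ∀ b ∈ A, s a = s b

/-- `N`: the maximal number of simultaneously accordable states. -/
def maxAccordable (μ : Measure Ω) (f : E × G → E) (V : ℤ → Ω → G) : ℕ :=
  sSup {m | ∃ A : Set E, SimultaneouslyAccordable μ f V A ∧ A.ncard = m}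

/-- `s` realizes a maximal accord: `s(E)` consists of `M` pairwise non accordable points. -/
def RealizesMaximalAccord (μ : Measure Ω) (f : E × G → E) (V : ℤ → Ω → G)
    (s : Function.End E) : Prop :=
  (Set.range s).ncard = maxNonaccordable μ f V ∧ PairwiseNonaccordable μ f V (Set.range s)

/-- There is a probability measure `α` equivalent to `β` with
`∫ Card (f_v⁻¹{y}) α(dv) = 1` for every `y`. -/
def UniformInvariantForEquivalentLaw (β : Measure G) (f : E × G → E) : Prop :=
  ∃ α : Measure G, IsProbabilityMeasure α ∧ α ≪ β ∧ β ≪ α ∧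
    ∀ y : E, ∫⁻ v, ({x : E | f (x, v) = y}.ncard : ℝ≥0∞) ∂α = 1

/-- The σ-algebra generated by `(Y k)`, `k ≤ n`, completed by the `μ`-null sets. -/
@[reducible]
def completedPast {F : Type*} [MeasurableSpace F] (μ : Measure Ω) (Y : ℤ → Ω → F) (n : ℤ) :
    MeasurableSpace Ω :=
  eventuallyMeasurableSpace (⨆ k : Set.Iic n, MeasurableSpace.comap (Y k) inferInstance) (ae μ)

end RecursiveChain

end

/-! Everything reduces to the finite semigroup `S`: `accordable_iff` says that `x`, `y` are
accordable iff some `s ∈ S` merges them. Preimages of simultaneously accordable sets under `S` are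
again simultaneously accordable. Let `A` be such a set with `N` elements. By hypothesis `𝓗` the
`α`-mean of `Card f_v⁻¹(A)` is `Card A = N`, while the integrand is at most `N`; hence it equals `N`
almost surely, and `Card s⁻¹(A) = N` for all `s ∈ S` (`ncard_preimage_of_mem_mapSemigroup`).

If the points of `s(E)` are pairwise non-accordable and `y ∈ s(E)`, irreducibility gives `u ∈ S`
with `u y ∈ A`. No other point of `s(E)` can be sent into `A` by `u`, so `(u ∘ s)⁻¹(A) = s⁻¹{y}` has
`N` elements (`ncard_fiber`). An `s` of minimal rank realizes a maximal accord, and counting `E` by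
its fibres gives `MN = Card E`.

For prime cardinality, `N = 1` or `N = Card E`. If `N = 1`, all maps are bijections, the transition
matrix is primitive and doubly stochastic, and starting ever further in the past forces uniform
laws; bijections preserve uniformity conditionally on `V`, whence independence. If `N = Card E`,
some word of `S` is constant; it almost surely occurs in the past, so `X n` is a function of past
innovations. -/

namespace RecursiveChain

/-! ### Compositions of the random maps. -/

section Flow

variable {Ω E G : Type*}

/-- The map `f_v : x ↦ f (x, v)`. -/
def stepMap (f : E × G → E) (v : G) : Function.End E := fun x => f (x, v)

/-- The composition `f_{V (m + l)} ∘ ⋯ ∘ f_{V (m + 1)}`. -/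
def flowFrom (f : E × G → E) (V : ℤ → Ω → G) (m : ℤ) : ℕ → Ω → Function.End E
  | 0, _ => 1
  | l + 1, ω => stepMap f (V (m + l + 1) ω) * flowFrom f V m l ω

/-- The set of innovations `v` with `f_v = h`. -/
def mapFiber (f : E × G → E) (h : Function.End E) : Set G := {v | stepMap f v = h}

variable {f : E × G → E} {V : ℤ → Ω → G}

lemma End.mul_apply (a b : Function.End E) (x : E) : (a * b) x = a (b x) := rfl

lemma stepMap_eq_iff {v : G} {h : Function.End E} : stepMap f v = h ↔ ∀ x, f (x, v) = h x :=
  funext_iff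

lemma flow_eq_flowFrom (l : ℕ) (ω : Ω) : flow f V l ω = flowFrom f V 0 l ω := by
  induction l with
  | zero => rfl
  | succ l ih =>
    funext x
    simp only [flow, flowFrom, ih, End.mul_apply, stepMap, zero_add]

lemma flowFrom_add (m : ℤ) (a b : ℕ) (ω : Ω) :
    flowFrom f V m (a + b) ω = flowFrom f V (m + a) b ω * flowFrom f V m a ω := by
  induction b with
  | zero => rfl
  | succ b ih =>
    rw [← add_assoc]
    simp only [flowFrom, ih, mul_assoc]
    push_cast
    rw [← add_assoc m]

end Flow

/-! ### The past and its independence from the next innovation. -/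

section Past

variable {Ω E G : Type*} [MeasurableSpace Ω] [MeasurableSpace E] [MeasurableSpace G]

/-- The σ-algebra generated by the pairs `(X k, V k)`, `k ≤ n`. -/
abbrev pastSigma (X : ℤ → Ω → E) (V : ℤ → Ω → G) (n : ℤ) : MeasurableSpace Ω :=
  MeasurableSpace.comap (fun ω (k : Set.Iic n) => (X k ω, V k ω)) inferInstance

variable {μ : Measure Ω} {β : Measure G} {f : E × G → E} {X : ℤ → Ω → E} {V : ℤ → Ω → G}

omit [MeasurableSpace Ω] in
lemma measurable_state_past {k n : ℤ} (hk : k ≤ n) : Measurable[pastSigma X V n] (X k) :=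
  (measurable_fst.comp (measurable_pi_apply (X := fun _ : Set.Iic n => E × G)
    (⟨k, hk⟩ : Set.Iic n))).comp (comap_measurable (fun ω (k : Set.Iic n) => (X k ω, V k ω)))

omit [MeasurableSpace Ω] in
lemma measurable_innovation_past {k n : ℤ} (hk : k ≤ n) : Measurable[pastSigma X V n] (V k) :=
  (measurable_snd.comp (measurable_pi_apply (X := fun _ : Set.Iic n => E × G)
    (⟨k, hk⟩ : Set.Iic n))).comp (comap_measurable (fun ω (k : Set.Iic n) => (X k ω, V k ω)))

omit [MeasurableSpace Ω] in
lemma pastSigma_mono {m n : ℤ} (h : m ≤ n) : pastSigma X V m ≤ pastSigma X V n := by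
  rw [← measurable_iff_comap_le]
  refine @measurable_pi_lambda _ _ _ (pastSigma X V n) _ _ fun k => ?_
  exact (measurable_state_past (k.2.trans h)).prodMk (measurable_innovation_past (k.2.trans h))

omit [MeasurableSpace Ω] in
lemma measurable_flowFrom (hf : Measurable f) {m : ℤ} {l : ℕ} {m₀ : MeasurableSpace Ω}
    (hV : ∀ k, m < k → k ≤ m + l → Measurable[m₀] (V k)) (x : E) :
    Measurable[m₀] fun ω => flowFrom f V m l ω x := by
  induction l with
  | zero => exact measurable_const
  | succ l ih =>
    refine hf.comp ((ih fun k h1 h2 => hV k h1 (by push_cast; lia)).prodMk ?_)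
    exact hV _ (by lia) (by push_cast; lia)

namespace IsRecursiveChain

variable (hc : IsRecursiveChain μ β f X V)
include hc

lemma pastSigma_le (n : ℤ) : pastSigma X V n ≤ ‹MeasurableSpace Ω› := by
  rw [← measurable_iff_comap_le]
  exact measurable_pi_lambda _ fun k =>
    (hc.measurable_state k).prodMk (hc.measurable_innovation k)

/-- The form in which `indep_past` is used: all later factorizations over time go through it. -/
lemma measure_inter_innovation {n : ℤ} {A : Set Ω} (hA : MeasurableSet[pastSigma X V n] A)
    {B : Set G} (hB : MeasurableSet B) : μ (A ∩ V (n + 1) ⁻¹' B) = μ A * β B := by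
  obtain ⟨A', hA', rfl⟩ := hA
  rw [Set.inter_comm, (hc.indep_past n).measure_inter_preimage_eq_mul _ _ hB hA', mul_comm,
    ← Measure.map_apply (hc.measurable_innovation _) hB, hc.law_innovation]

lemma measurable_flowFrom_past (m : ℤ) (l : ℕ) (x : E) :
    Measurable[pastSigma X V (m + l)] fun ω => flowFrom f V m l ω x :=
  measurable_flowFrom hc.measurable_map (fun _ _ h => measurable_innovation_past h) x

lemma ae_state_eq_flowFrom : ∀ᵐ ω ∂μ, ∀ (m : ℤ) (l : ℕ),
    X (m + l) ω = flowFrom f V m l ω (X m ω) := by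
  filter_upwards [ae_all_iff.2 hc.recursion] with ω hω m l
  induction l with
  | zero => simp [flowFrom]; rfl
  | succ l ih =>
    simp only [flowFrom, End.mul_apply, ← ih, stepMap, ← hω]
    push_cast
    rw [add_assoc]

end IsRecursiveChain

end Past

/-! ### Elements of `S` as words read by the flow with positive probability. -/

section Words

lemma nonempty_of_process {Ω E : Type*} [MeasurableSpace Ω] (μ : Measure Ω)
    [IsProbabilityMeasure μ] (X : ℤ → Ω → E) : Nonempty E := by
  obtain ⟨ω, -⟩ := nonempty_of_measure_ne_zero (μ := μ) (s := Set.univ) (by simp)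
  exact ⟨X 0 ω⟩

/-- Pigeonhole: a finite set has finitely many self-maps. -/
lemma exists_measure_inter_eq_ne_zero {Ω E : Type*} [MeasurableSpace Ω] [Finite E] {μ : Measure Ω}
    {A : Set Ω} (hA : μ A ≠ 0) (W : Ω → Function.End E) :
    ∃ h : Function.End E, μ (A ∩ {ω | W ω = h}) ≠ 0 := by
  by_contra! hcon
  have : Finite (Function.End E) := inferInstanceAs (Finite (E → E))
  refine hA (measure_mono_null (t := ⋃ h, A ∩ {ω | W ω = h}) (fun ω hω => ?_)
    (measure_iUnion_null hcon))
  exact Set.mem_iUnion.2 ⟨W ω, hω, rfl⟩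

variable {Ω E G : Type*} [MeasurableSpace Ω] [MeasurableSpace G]
  [Fintype E] [MeasurableSpace E] [MeasurableSingletonClass E]
  {μ : Measure Ω} {β : Measure G} {f : E × G → E} {X : ℤ → Ω → E} {V : ℤ → Ω → G}

lemma measurableSet_mapFiber (hf : Measurable f) (h : Function.End E) :
    MeasurableSet (mapFiber f h) := by
  have : mapFiber f h = ⋂ x, (fun v => f (x, v)) ⁻¹' {h x} := by
    ext v; simp [mapFiber, stepMap_eq_iff]
  rw [this]
  exact MeasurableSet.iInter fun x =>
    (hf.comp (measurable_const.prodMk measurable_id)) (measurableSet_singleton (h x))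

omit [MeasurableSpace G] [Fintype E] [MeasurableSpace E] [MeasurableSingletonClass E] in
lemma exists_list_of_mem_mapSemigroup {s : Function.End E} (hs : s ∈ mapSemigroup μ f V) :
    ∃ L : List (Function.End E), L ≠ [] ∧ (∀ h ∈ L, h ∈ essentialMaps μ f V) ∧ L.prod = s := by
  induction hs using Subsemigroup.closure_induction with
  | mem x hx => exact ⟨[x], by simp, by simpa using hx, by simp⟩
  | mul x y _ _ h1 h2 =>
    obtain ⟨L₁, h₁, h₁', rfl⟩ := h1
    obtain ⟨L₂, -, h₂', rfl⟩ := h2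
    refine ⟨L₁ ++ L₂, by simp [h₁], fun h hh => ?_, by simp⟩
    exact (List.mem_append.1 hh).elim (h₁' h) (h₂' h)

namespace IsRecursiveChain

variable (hc : IsRecursiveChain μ β f X V)
include hc

lemma measure_map_eq (n : ℤ) (h : Function.End E) :
    μ {ω | stepMap f (V n ω) = h} = β (mapFiber f h) := by
  rw [← hc.law_innovation n, Measure.map_apply (hc.measurable_innovation n)
    (measurableSet_mapFiber hc.measurable_map h)]
  rfl

lemma mem_essentialMaps_iff {h : Function.End E} :
    h ∈ essentialMaps μ f V ↔ 0 < β (mapFiber f h) := by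
  rw [← hc.measure_map_eq 1, essentialMaps]
  simp only [stepMap_eq_iff, Set.mem_ofPred_eq]

lemma measurableSet_flowFrom_eq (m : ℤ) (l : ℕ) (h : Function.End E) :
    MeasurableSet[pastSigma X V (m + l)] {ω | flowFrom f V m l ω = h} := by
  have : {ω | flowFrom f V m l ω = h} = ⋂ x, (fun ω => flowFrom f V m l ω x) ⁻¹' {h x} := by
    ext ω; simp only [Set.mem_ofPred_eq, Set.mem_iInter, Set.mem_preimage,
      Set.mem_singleton_iff]; exact funext_iff
  rw [this]
  exact MeasurableSet.iInter fun x =>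
    hc.measurable_flowFrom_past m l x (measurableSet_singleton _)

/-- The head of the list is the last map applied, hence the newest innovation, independent of the
rest. Only an inequality holds, since different words may have the same product. -/
lemma mul_le_measure_inter_flowFrom_eq_prod (m : ℤ) {A : Set Ω}
    (hA : MeasurableSet[pastSigma X V m] A) (L : List (Function.End E)) :
    μ A * (L.map fun h => β (mapFiber f h)).prod ≤
      μ (A ∩ {ω | flowFrom f V m L.length ω = L.prod}) := by
  induction L with
  | nil =>
    have : {ω | flowFrom f V m 0 ω = (1 : Function.End E)} = Set.univ := by
      ext ω; simp only [Set.mem_ofPred_eq, Set.mem_univ, iff_true]; rfl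
    simp only [List.map_nil, List.prod_nil, mul_one, List.length_nil, this, Set.inter_univ, le_refl]
  | cons h L ih =>
    have hm : MeasurableSet[pastSigma X V (m + L.length)]
        (A ∩ {ω | flowFrom f V m L.length ω = L.prod}) :=
      MeasurableSet.inter (pastSigma_mono (by lia) _ hA) (hc.measurableSet_flowFrom_eq _ _ _)
    rw [List.map_cons, List.prod_cons, mul_left_comm, mul_comm]
    refine (mul_le_mul_left ih _).trans ?_
    rw [← hc.measure_inter_innovation hm (measurableSet_mapFiber hc.measurable_map h)]
    refine measure_mono ?_
    rintro ω ⟨⟨h1, h2⟩, h3⟩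
    refine ⟨h1, ?_⟩
    simp only [Set.mem_ofPred_eq] at h2 ⊢
    rw [List.length_cons, flowFrom, h2, List.prod_cons, show stepMap f (V _ ω) = h from h3]

/-- The length is `l + 1` because the empty flow is the identity, which need not lie in `S`. -/
lemma mem_mapSemigroup_of_flowFrom {l : ℕ} {s : Function.End E}
    (hs : μ {ω | flowFrom f V 0 (l + 1) ω = s} ≠ 0) : s ∈ mapSemigroup μ f V := by
  induction l generalizing s with
  | zero =>
    refine Subsemigroup.subset_closure ?_
    rw [essentialMaps, Set.mem_ofPred_eq, pos_iff_ne_zero]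
    simpa only [flowFrom, mul_one, stepMap_eq_iff, Nat.cast_zero, zero_add] using hs
  | succ l ih =>
    obtain ⟨b, hb⟩ := exists_measure_inter_eq_ne_zero hs (flowFrom f V 0 (l + 1))
    obtain ⟨a, ha⟩ := exists_measure_inter_eq_ne_zero hb
      (fun ω => stepMap f (V (0 + (l + 1 : ℕ) + 1) ω))
    have hb' : b ∈ mapSemigroup μ f V :=
      ih fun h0 => hb (measure_mono_null Set.inter_subset_right h0)
    have ha' : a ∈ mapSemigroup μ f V := by
      refine Subsemigroup.subset_closure (hc.mem_essentialMaps_iff.2 ?_)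
      rw [← hc.measure_map_eq (0 + (l + 1 : ℕ) + 1), pos_iff_ne_zero]
      exact fun h0 => ha (measure_mono_null Set.inter_subset_right h0)
    obtain ⟨ω, ⟨h1, h2⟩, h3⟩ := nonempty_of_measure_ne_zero ha
    have : s = a * b := by
      simp only [Set.mem_ofPred_eq] at h1 h2 h3
      rw [← h1, ← h2, ← h3, ← flowFrom]
    rw [this]
    exact mul_mem ha' hb'

/-- `l` and `q` depend on `s` alone, not on `m` or the past event `A`; this uniformity makes
coalescence geometric. -/
lemma exists_flowFrom_pos [IsProbabilityMeasure μ] {s : Function.End E}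
    (hs : s ∈ mapSemigroup μ f V) :
    ∃ l : ℕ, ∃ q : ℝ≥0∞, 0 < l ∧ 0 < q ∧ ∀ (m : ℤ) (A : Set Ω),
      MeasurableSet[pastSigma X V m] A → μ A * q ≤ μ (A ∩ {ω | flowFrom f V m l ω = s}) := by
  obtain ⟨L, hL, hLH, rfl⟩ := exists_list_of_mem_mapSemigroup hs
  refine ⟨L.length, (L.map fun h => β (mapFiber f h)).prod, List.length_pos_iff.2 hL, ?_,
    fun m A hA => hc.mul_le_measure_inter_flowFrom_eq_prod m hA L⟩
  rw [pos_iff_ne_zero]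
  refine List.prod_ne_zero ?_
  simp only [List.mem_map, not_exists, not_and]
  exact fun h hh => (hc.mem_essentialMaps_iff.1 (hLH h hh)).ne'

lemma accordable_iff [IsProbabilityMeasure μ] {x y : E} :
    Accordable μ f V x y ↔ ∃ s ∈ mapSemigroup μ f V, s x = s y := by
  simp only [Accordable, flow_eq_flowFrom]
  constructor
  · rintro ⟨l, hl, hpos⟩
    obtain ⟨l, rfl⟩ := Nat.exists_eq_succ_of_ne_zero (by lia : l ≠ 0)
    obtain ⟨s, hs⟩ := exists_measure_inter_eq_ne_zero hpos.ne' (flowFrom f V 0 (l + 1))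
    refine ⟨s, hc.mem_mapSemigroup_of_flowFrom
      fun h0 => hs (measure_mono_null Set.inter_subset_right h0), ?_⟩
    obtain ⟨ω, h1, h2⟩ := nonempty_of_measure_ne_zero hs
    simp only [Set.mem_ofPred_eq] at h1 h2
    rwa [← h2]
  · rintro ⟨s, hs, hxy⟩
    obtain ⟨l, q, hl, hq, h⟩ := hc.exists_flowFrom_pos hs
    have := h 0 Set.univ MeasurableSet.univ
    simp only [measure_univ, one_mul, Set.univ_inter] at this
    refine ⟨l, hl, (hq.trans_le this).trans_le (measure_mono fun ω hω => ?_)⟩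
    simp only [Set.mem_ofPred_eq] at hω ⊢
    rw [hω, hxy]

end IsRecursiveChain

end Words

/-! ### Maximal accords and the identity `MN = Card E`. -/

section Accord

variable {Ω E G : Type*} [MeasurableSpace Ω] [MeasurableSpace G]
  [Fintype E] [MeasurableSpace E] [MeasurableSingletonClass E]
  {μ : Measure Ω} {β : Measure G} {f : E × G → E} {X : ℤ → Ω → E} {V : ℤ → Ω → G}

omit [MeasurableSpace G] [Fintype E] [MeasurableSpace E] [MeasurableSingletonClass E] in
lemma SimultaneouslyAccordable.preimage {A : Set E} (hA : SimultaneouslyAccordable μ f V A)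
    {s : Function.End E} (hs : s ∈ mapSemigroup μ f V) :
    SimultaneouslyAccordable μ f V (s ⁻¹' A) := by
  obtain ⟨t, ht, h⟩ := hA
  exact ⟨t * s, mul_mem ht hs, fun a ha b hb => h _ ha _ hb⟩

omit [MeasurableSpace G] [Fintype E] [MeasurableSpace E] [MeasurableSingletonClass E] in
lemma simultaneouslyAccordable_fiber {s : Function.End E} (hs : s ∈ mapSemigroup μ f V) (y : E) :
    SimultaneouslyAccordable μ f V (s ⁻¹' {y}) :=
  ⟨s, hs, fun a ha b hb => by
    rw [Set.mem_singleton_iff.1 ha, Set.mem_singleton_iff.1 hb]⟩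

omit [MeasurableSpace E] [MeasurableSingletonClass E] in
lemma bddAbove_ncard (p : Set E → Prop) : BddAbove {m | ∃ A : Set E, p A ∧ A.ncard = m} := by
  refine ⟨Fintype.card E, ?_⟩
  rintro m ⟨A, -, rfl⟩
  rw [← Nat.card_eq_fintype_card, ← Set.ncard_univ]
  exact Set.ncard_le_ncard (Set.subset_univ A)

omit [MeasurableSpace G] [MeasurableSpace E] [MeasurableSingletonClass E] in
lemma SimultaneouslyAccordable.ncard_le {A : Set E} (hA : SimultaneouslyAccordable μ f V A) :
    A.ncard ≤ maxAccordable μ f V :=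
  le_csSup (bddAbove_ncard _) ⟨A, hA, rfl⟩

omit [MeasurableSpace G] [MeasurableSpace E] [MeasurableSingletonClass E] in
lemma bijective_of_maxAccordable_eq_one (hN : maxAccordable μ f V = 1)
    {h : Function.End E} (hh : h ∈ mapSemigroup μ f V) : Function.Bijective h := by
  refine Finite.injective_iff_bijective.1 fun x y hxy => ?_
  have := (simultaneouslyAccordable_fiber hh (h y)).ncard_le
  rw [hN] at this
  exact (Set.ncard_le_one).1 this x hxy y rfl

omit [MeasurableSpace G] [Fintype E] [MeasurableSpace E] [MeasurableSingletonClass E] in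
lemma bijective_of_forall_essentialMaps
    (hbij : ∀ h ∈ essentialMaps μ f V, Function.Bijective h)
    {s : Function.End E} (hs : s ∈ mapSemigroup μ f V) : Function.Bijective s := by
  induction hs using Subsemigroup.closure_induction with
  | mem g hg => exact hbij g hg
  | mul a b _ _ iha ihb => exact Function.Bijective.comp iha ihb

omit [MeasurableSpace G] [MeasurableSpace E] [MeasurableSingletonClass E] in
lemma PairwiseNonaccordable.ncard_le {A : Set E} (hA : PairwiseNonaccordable μ f V A) :
    A.ncard ≤ maxNonaccordable μ f V :=
  le_csSup (bddAbove_ncard _) ⟨A, hA, rfl⟩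

omit [MeasurableSpace G] [MeasurableSpace E] [MeasurableSingletonClass E] in
lemma exists_pairwiseNonaccordable_ncard_eq :
    ∃ A : Set E, PairwiseNonaccordable μ f V A ∧ A.ncard = maxNonaccordable μ f V :=
  Nat.sSup_mem (s := {m | ∃ A : Set E, PairwiseNonaccordable μ f V A ∧ A.ncard = m})
    ⟨0, ∅, Set.pairwise_empty _, by simp⟩ (bddAbove_ncard _)

lemma measurable_comp_stepMap (hf : Measurable f) {F : Type*} [MeasurableSpace F]
    (g : Function.End E → F) : Measurable fun v => g (stepMap f v) := by
  have : Finite (Function.End E) := inferInstanceAs (Finite (E → E))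
  intro B _
  have : (fun v => g (stepMap f v)) ⁻¹' B = ⋃ h ∈ g ⁻¹' B, mapFiber f h := by
    ext v; simp [mapFiber]
  rw [this]
  exact MeasurableSet.biUnion (Set.toFinite _).countable fun h _ => measurableSet_mapFiber hf h

omit [MeasurableSpace E] [MeasurableSingletonClass E] in
lemma ncard_preimage_eq_sum (h : Function.End E) (A : Finset E) :
    (h ⁻¹' (A : Set E)).ncard = ∑ y ∈ A, (h ⁻¹' {y}).ncard := by
  classical
  have h1 : ∀ B : Set E, (h ⁻¹' B).ncard = (Finset.univ.filter fun x => h x ∈ B).card := by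
    intro B
    rw [← Set.ncard_coe_finset]
    congr 1; ext; simp; rfl
  simp only [h1]
  rw [Finset.card_eq_sum_card_fiberwise (f := h) (t := A) (fun x hx => by simpa using hx)]
  refine Finset.sum_congr rfl fun y hy => ?_
  congr 1; ext x
  simp only [Finset.mem_filter, Finset.mem_univ, true_and, Set.mem_singleton_iff, Finset.mem_coe]
  exact ⟨fun h => h.2, fun h => ⟨h ▸ hy, h⟩⟩

namespace IsRecursiveChain

variable (hc : IsRecursiveChain μ β f X V)
include hc

lemma exists_mem_essentialMaps {n : ℤ} {A : Set Ω} (hA : μ A ≠ 0) :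
    ∃ h ∈ essentialMaps μ f V, ∃ ω ∈ A, stepMap f (V n ω) = h := by
  obtain ⟨h, hh⟩ := exists_measure_inter_eq_ne_zero hA fun ω => stepMap f (V n ω)
  refine ⟨h, hc.mem_essentialMaps_iff.2 ?_, nonempty_of_measure_ne_zero hh⟩
  rw [← hc.measure_map_eq n, pos_iff_ne_zero]
  exact fun h0 => hh (measure_mono_null Set.inter_subset_right h0)

/-- The inessential maps are finitely many, each with a `β`-null fibre. -/
lemma ae_stepMap_mem : ∀ᵐ v ∂β, stepMap f v ∈ essentialMaps μ f V := by
  have : Finite (Function.End E) := inferInstanceAs (Finite (E → E))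
  refine measure_mono_null (t := ⋃ h ∈ (essentialMaps μ f V)ᶜ, mapFiber f h) (fun v hv => ?_) ?_
  · simpa [mapFiber] using hv
  · refine (measure_biUnion_null_iff (Set.toFinite _).countable).2 fun h hh => ?_
    by_contra h0
    exact hh (hc.mem_essentialMaps_iff.2 (pos_iff_ne_zero.2 h0))

lemma exists_essentialMaps_of_transitionMatrix_pos {x y : E}
    (h : 0 < transitionMatrix μ f V x y) : ∃ s ∈ essentialMaps μ f V, s x = y := by
  simp only [transitionMatrix, Matrix.of_apply] at h
  have h0 : μ {ω | f (x, V 1 ω) = y} ≠ 0 := by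
    intro h0; simp [measureReal_def, h0] at h
  obtain ⟨s, hs, ω, hω, rfl⟩ := hc.exists_mem_essentialMaps (n := 1) h0
  exact ⟨_, hs, hω⟩

lemma exists_mem_mapSemigroup_apply_eq
    (hirr : (transitionMatrix μ f V).IsIrreducible) (x y : E) :
    ∃ s ∈ mapSemigroup μ f V, s x = y := by
  classical
  obtain ⟨k, hk, hpos⟩ := (Matrix.isIrreducible_iff_exists_pow_pos hirr.nonneg).1 hirr x y
  obtain ⟨k, rfl⟩ := Nat.exists_eq_succ_of_ne_zero hk.ne'
  clear hk
  induction k generalizing y with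
  | zero =>
    obtain ⟨s, hs, h⟩ := hc.exists_essentialMaps_of_transitionMatrix_pos (by simpa using hpos)
    exact ⟨s, Subsemigroup.subset_closure hs, h⟩
  | succ k ih =>
    rw [Nat.succ_eq_add_one, pow_succ, Matrix.mul_apply] at hpos
    obtain ⟨z, -, hz⟩ : ∃ z ∈ Finset.univ,
        0 < (transitionMatrix μ f V ^ (k + 1)) x z * transitionMatrix μ f V z y := by
      by_contra! hcon
      exact (Finset.sum_nonpos hcon).not_gt hpos
    have h1 := Matrix.pow_apply_nonneg hirr.nonneg (k + 1) x z
    have h2 := hirr.nonneg z y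
    obtain ⟨s, hs, rfl⟩ := ih z (pos_of_mul_pos_left hz h2)
    obtain ⟨t, ht, rfl⟩ := hc.exists_essentialMaps_of_transitionMatrix_pos
      (pos_of_mul_pos_right hz h1)
    exact ⟨t * s, mul_mem (Subsemigroup.subset_closure ht) hs, rfl⟩

variable [IsProbabilityMeasure μ]

lemma exists_mem_mapSemigroup : ∃ s, s ∈ mapSemigroup μ f V := by
  obtain ⟨h, hh, -⟩ := hc.exists_mem_essentialMaps (n := 0) (A := Set.univ) (by simp)
  exact ⟨h, Subsemigroup.subset_closure hh⟩

lemma exists_simultaneouslyAccordable_ncard_eq :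
    ∃ A : Set E, SimultaneouslyAccordable μ f V A ∧ A.ncard = maxAccordable μ f V := by
  obtain ⟨s, hs⟩ := hc.exists_mem_mapSemigroup
  exact Nat.sSup_mem (s := {m | ∃ A : Set E, SimultaneouslyAccordable μ f V A ∧ A.ncard = m})
    ⟨0, ∅, ⟨s, hs, by simp⟩, by simp⟩ (bddAbove_ncard _)

lemma maxAccordable_pos : 0 < maxAccordable μ f V := by
  obtain ⟨s, hs⟩ := hc.exists_mem_mapSemigroup
  obtain ⟨x⟩ := nonempty_of_process μ X
  have : SimultaneouslyAccordable μ f V {x} :=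
    ⟨s, hs, fun a ha b hb => by rw [Set.mem_singleton_iff.1 ha, Set.mem_singleton_iff.1 hb]⟩
  simpa [Nat.one_le_iff_ne_zero, pos_iff_ne_zero] using this.ncard_le

omit [IsProbabilityMeasure μ] in
-- A function bounded by `N` with mean `N` is almost surely `N`. Equivalence of `α` and `β`
-- transfers the bound to `α`-almost every `v` and the equality back to each `h ∈ H`.
lemma ncard_preimage_of_mem_essentialMaps (hH : UniformInvariantForEquivalentLaw β f)
    {A : Set E} (hA : SimultaneouslyAccordable μ f V A) (hAN : A.ncard = maxAccordable μ f V)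
    {h : Function.End E} (hh : h ∈ essentialMaps μ f V) :
    (h ⁻¹' A).ncard = maxAccordable μ f V := by
  classical
  obtain ⟨α, hα, hαβ, hβα, hint⟩ := hH
  have hmeas : ∀ B : Set E, Measurable fun v => ((stepMap f v ⁻¹' B).ncard : ℝ≥0∞) := fun B =>
    measurable_comp_stepMap hc.measurable_map fun s => ((s ⁻¹' B).ncard : ℝ≥0∞)
  have hle : (fun v => ((stepMap f v ⁻¹' A).ncard : ℝ≥0∞)) ≤ᵐ[α]
      fun _ => (maxAccordable μ f V : ℝ≥0∞) := by
    filter_upwards [hαβ.ae_le hc.ae_stepMap_mem] with v hv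
    exact_mod_cast (hA.preimage (Subsemigroup.subset_closure hv)).ncard_le
  have hsum : ∫⁻ v, ((stepMap f v ⁻¹' A).ncard : ℝ≥0∞) ∂α = maxAccordable μ f V := by
    have : ∀ v, ((stepMap f v ⁻¹' A).ncard : ℝ≥0∞) =
        ∑ y ∈ A.toFinset, ((stepMap f v ⁻¹' {y}).ncard : ℝ≥0∞) := fun v => by
      have := ncard_preimage_eq_sum (stepMap f v) A.toFinset
      rw [Set.coe_toFinset] at this
      exact_mod_cast this
    simp only [this]
    rw [lintegral_finsetSum _ fun y _ => hmeas {y}]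
    have h1 : ∀ y, ∫⁻ v, ((stepMap f v ⁻¹' {y}).ncard : ℝ≥0∞) ∂α = 1 := hint
    simp only [h1, Finset.sum_const, nsmul_eq_mul, mul_one, ← Set.ncard_eq_toFinset_card', hAN]
  have heq := ae_eq_of_ae_le_of_lintegral_le hle (by rw [hsum]; exact ENNReal.natCast_ne_top _)
    measurable_const.aemeasurable (by simp [hsum])
  -- Since `β ≪ α`, the fibre of `h` is not `α`-null and so contains a `v` at which equality holds.
  have hpos : α (mapFiber f h) ≠ 0 := fun h0 =>
    (hc.mem_essentialMaps_iff.1 hh).ne' (hβα h0)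
  obtain ⟨v, hv, hv'⟩ := Filter.Frequently.and_eventually
    (frequently_ae_mem_iff.2 hpos) heq |>.exists
  rw [mapFiber, Set.mem_ofPred_eq] at hv
  subst hv
  exact Nat.cast_injective (R := ℝ≥0∞) hv'

omit [IsProbabilityMeasure μ] in
lemma ncard_preimage_of_mem_mapSemigroup (hH : UniformInvariantForEquivalentLaw β f)
    {s : Function.End E} (hs : s ∈ mapSemigroup μ f V)
    {A : Set E} (hA : SimultaneouslyAccordable μ f V A) (hAN : A.ncard = maxAccordable μ f V) :
    (s ⁻¹' A).ncard = maxAccordable μ f V := by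
  induction hs using Subsemigroup.closure_induction generalizing A with
  | mem h hh => exact hc.ncard_preimage_of_mem_essentialMaps hH hA hAN hh
  | mul a b ha _ iha ihb => exact ihb (hA.preimage ha) (iha hA hAN)

/-- A map whose image has pairwise non accordable points has fibres of maximal size. -/
lemma ncard_fiber (hH : UniformInvariantForEquivalentLaw β f)
    (hirr : (transitionMatrix μ f V).IsIrreducible)
    {s : Function.End E} (hs : s ∈ mapSemigroup μ f V)
    (hna : PairwiseNonaccordable μ f V (Set.range s)) {y : E} (hy : y ∈ Set.range s) :
    (s ⁻¹' {y}).ncard = maxAccordable μ f V := by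
  obtain ⟨A, hA, hAN⟩ := hc.exists_simultaneouslyAccordable_ncard_eq
  obtain ⟨z, hz⟩ : A.Nonempty := by
    rw [← Set.ncard_pos, hAN]; exact hc.maxAccordable_pos
  -- With `u y ∈ A`, the fibre over `y` is the preimage of `A` under `u * s`: another point of the
  -- range sent into `A` would be merged with `y` by the map constant on `A`.
  obtain ⟨u, hu, rfl⟩ := hc.exists_mem_mapSemigroup_apply_eq hirr y z
  rw [← hc.ncard_preimage_of_mem_mapSemigroup hH (mul_mem hu hs) hA hAN]
  congr 1
  ext x
  change s x = y ↔ u (s x) ∈ A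
  refine ⟨fun h => h ▸ hz, fun h => ?_⟩
  by_contra hne
  obtain ⟨t, ht, hconst⟩ := hA
  exact hna ⟨x, rfl⟩ hy hne (hc.accordable_iff.2 ⟨t * u, mul_mem ht hu, hconst _ h _ hz⟩)

/-- Elements of `S` are injective on pairwise non-accordable sets. -/
lemma maxNonaccordable_le_ncard_range {s : Function.End E} (hs : s ∈ mapSemigroup μ f V) :
    maxNonaccordable μ f V ≤ (Set.range s).ncard := by
  obtain ⟨A, hA, hAM⟩ := exists_pairwiseNonaccordable_ncard_eq (μ := μ) (f := f) (V := V)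
  rw [← hAM, ← Set.InjOn.ncard_image (f := s) (s := A) fun x hx y hy hxy => ?_]
  · exact Set.ncard_le_ncard (Set.image_subset_range _ _)
  · by_contra hne
    exact hA hx hy hne (hc.accordable_iff.2 ⟨s, hs, hxy⟩)

/-- Take `s` of minimal rank: merging two accordable points of its range would lower the rank. -/
lemma exists_realizesMaximalAccord :
    ∃ s ∈ mapSemigroup μ f V, RealizesMaximalAccord μ f V s := by
  obtain ⟨s, hs, hmin⟩ := exists_minimalFor_of_wellFoundedLT (· ∈ mapSemigroup μ f V)
    (fun s : Function.End E => (Set.range s).ncard) hc.exists_mem_mapSemigroup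
  have hna : PairwiseNonaccordable μ f V (Set.range s) := by
    rintro _ ⟨x, rfl⟩ _ ⟨y, rfl⟩ hne hacc
    obtain ⟨t, ht, hxy⟩ := hc.accordable_iff.1 hacc
    have hlt : (Set.range (t * s)).ncard < (Set.range s).ncard := by
      rw [show Set.range (t * s) = t '' Set.range s from Set.range_comp t s]
      refine lt_of_le_of_ne (Set.ncard_image_le) fun heq => ?_
      exact hne ((Set.injOn_of_ncard_image_eq heq) ⟨x, rfl⟩ ⟨y, rfl⟩ hxy)
    exact absurd (hmin (mul_mem ht hs) hlt.le) (not_le.2 hlt)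
  exact ⟨s, hs, le_antisymm hna.ncard_le (hc.maxNonaccordable_le_ncard_range hs), hna⟩

lemma maxNonaccordable_mul_maxAccordable (hH : UniformInvariantForEquivalentLaw β f)
    (hirr : (transitionMatrix μ f V).IsIrreducible) :
    maxNonaccordable μ f V * maxAccordable μ f V = Fintype.card E := by
  classical
  obtain ⟨s, hs, hM, hna⟩ := hc.exists_realizesMaximalAccord
  have := ncard_preimage_eq_sum s (Set.range s).toFinset
  rw [Set.coe_toFinset, show s ⁻¹' Set.range s = Set.univ from Set.preimage_range s,
    Set.ncard_univ, Nat.card_eq_fintype_card] at this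
  rw [this, Finset.sum_congr rfl fun y hy => hc.ncard_fiber hH hirr hs hna (Set.mem_toFinset.1 hy),
    Finset.sum_const, smul_eq_mul, ← hM, Set.ncard_eq_toFinset_card']

lemma simultaneouslyAccordable_univ (hN : maxAccordable μ f V = Fintype.card E) :
    SimultaneouslyAccordable μ f V Set.univ := by
  obtain ⟨A, hA, hAN⟩ := hc.exists_simultaneouslyAccordable_ncard_eq
  rw [hN, ← Nat.card_eq_fintype_card, ← Set.ncard_univ] at hAN
  rwa [← Set.eq_of_subset_of_ncard_le (Set.subset_univ A) hAN.ge]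

end IsRecursiveChain

end Accord

/-! ### Coalescence from the past when some word is constant. -/

section Coalescence

variable {Ω E G : Type*} [MeasurableSpace Ω] [MeasurableSpace G]
  [Fintype E] [MeasurableSpace E] [MeasurableSingletonClass E]
  {μ : Measure Ω} {β : Measure G} {f : E × G → E} {X : ℤ → Ω → E} {V : ℤ → Ω → G}

omit [MeasurableSpace Ω] in
-- The σ-algebra is arbitrary so as to cover both `pastSigma` and the one generated by `V` alone.
lemma measurableSet_flowFrom_mem (hf : Measurable f) {m : ℤ} {l : ℕ} {m₀ : MeasurableSpace Ω}
    (hV : ∀ k, m < k → k ≤ m + l → Measurable[m₀] (V k)) (B : Set (Function.End E)) :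
    MeasurableSet[m₀] {ω | flowFrom f V m l ω ∈ B} := by
  have : Finite (Function.End E) := inferInstanceAs (Finite (E → E))
  have : {ω | flowFrom f V m l ω ∈ B} =
      ⋃ h ∈ B, ⋂ x, (fun ω => flowFrom f V m l ω x) ⁻¹' {h x} := by
    ext ω
    simp only [Set.mem_ofPred_eq, Set.mem_iUnion, Set.mem_iInter, Set.mem_preimage,
      Set.mem_singleton_iff, exists_prop]
    exact ⟨fun h => ⟨_, h, fun _ => rfl⟩, fun ⟨h, hB, hx⟩ => (funext hx : _ = h) ▸ hB⟩
  rw [this]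
  exact MeasurableSet.biUnion (Set.toFinite _).countable fun h _ =>
    MeasurableSet.iInter fun x => measurable_flowFrom hf hV x (measurableSet_singleton _)

namespace IsRecursiveChain

variable (hc : IsRecursiveChain μ β f X V)
include hc

variable [IsProbabilityMeasure μ]

/-- Cut time into `j` blocks of length `l`: given its past, each reads the constant word with
probability at least `q`, and one success makes the whole flow constant. -/
lemma exists_measure_flowFrom_not_const_le (huniv : SimultaneouslyAccordable μ f V Set.univ) :
    ∃ l : ℕ, ∃ r : ℝ≥0∞, r < 1 ∧ ∀ (m : ℤ) (j : ℕ),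
      μ {ω | ¬ ∀ x y, flowFrom f V m (j * l) ω x = flowFrom f V m (j * l) ω y} ≤ r ^ j := by
  obtain ⟨s, hs, hconst⟩ := huniv
  obtain ⟨l, q, -, hq, h⟩ := hc.exists_flowFrom_pos hs
  refine ⟨l, 1 - q, ENNReal.sub_lt_self ENNReal.one_ne_top one_ne_zero hq.ne', fun m j => ?_⟩
  induction j with
  | zero => simpa using prob_le_one
  | succ j ih =>
    have hD : MeasurableSet[pastSigma X V (m + (j * l : ℕ))]
        {ω | ¬ ∀ x y, flowFrom f V m (j * l) ω x = flowFrom f V m (j * l) ω y} :=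
      measurableSet_flowFrom_mem hc.measurable_map (fun _ _ hk => measurable_innovation_past hk)
        {g | ¬ ∀ x y, g x = g y}
    have hT : MeasurableSet {ω | flowFrom f V (m + (j * l : ℕ)) l ω = s} :=
      hc.pastSigma_le _ _ (hc.measurableSet_flowFrom_eq _ l s)
    have hsub : {ω | ¬ ∀ x y, flowFrom f V m ((j + 1) * l) ω x
          = flowFrom f V m ((j + 1) * l) ω y} ⊆
        {ω | ¬ ∀ x y, flowFrom f V m (j * l) ω x = flowFrom f V m (j * l) ω y} \
          {ω | flowFrom f V (m + (j * l : ℕ)) l ω = s} := by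
      intro ω hω
      rw [Set.mem_ofPred_eq, add_mul, one_mul, flowFrom_add] at hω
      refine ⟨fun hcon => hω fun x y => ?_, fun hcon => hω fun x y => ?_⟩
      · rw [End.mul_apply, End.mul_apply, hcon x y]
      · rw [Set.mem_ofPred_eq] at hcon
        rw [End.mul_apply, End.mul_apply, hcon]
        exact hconst _ trivial _ trivial
    refine (measure_mono hsub).trans ?_
    have h1 := measure_inter_add_sdiff (μ := μ)
      {ω | ¬ ∀ x y, flowFrom f V m (j * l) ω x = flowFrom f V m (j * l) ω y} hT
    rw [add_comm] at h1
    rw [ENNReal.eq_sub_of_add_eq (measure_ne_top _ _) h1]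
    refine (tsub_le_tsub_left (h _ _ hD) _).trans ?_
    rw [pow_succ]
    refine le_trans ?_ (mul_le_mul_left ih _)
    rw [ENNReal.mul_sub fun _ _ => measure_ne_top _ _, mul_one]

lemma ae_exists_flowFrom_const (huniv : SimultaneouslyAccordable μ f V Set.univ) (n : ℤ) :
    ∀ᵐ ω ∂μ, ∃ k : ℕ, ∀ x y, flowFrom f V (n - k) k ω x = flowFrom f V (n - k) k ω y := by
  obtain ⟨l, r, hr, h⟩ := hc.exists_measure_flowFrom_not_const_le huniv
  refine le_antisymm (ge_of_tendsto' (ENNReal.tendsto_pow_atTop_nhds_zero_of_lt_one hr)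
    fun j => ?_) zero_le
  refine (measure_mono fun ω hω => ?_).trans (h (n - (j * l : ℕ)) j)
  exact not_exists.1 hω _

/-- Once the flow from `k - l` to `k` is constant, its value is `X k` whatever `X (k - l)` was. -/
lemma measurable_state_completedPast (huniv : SimultaneouslyAccordable μ f V Set.univ)
    {k n : ℤ} (hk : k ≤ n) : Measurable[completedPast μ V n] (X k) := by
  refine @measurable_to_countable' _ _ _ _ (completedPast μ V n) _ fun x => ?_
  refine ⟨⋃ l : ℕ, {ω | flowFrom f V (k - l) l ω ∈ {g : Function.End E | ∀ y, g y = x}},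
    MeasurableSet.iUnion fun l => measurableSet_flowFrom_mem hc.measurable_map
      (fun i _ hi => ?_) _, ?_⟩
  · rw [measurable_iff_comap_le]
    exact le_iSup (fun k : Set.Iic n => MeasurableSpace.comap (V k) inferInstance)
      ⟨i, by simp only [Set.mem_Iic]; lia⟩
  · filter_upwards [hc.ae_exists_flowFrom_const huniv k, hc.ae_state_eq_flowFrom] with ω h1 h2
    have h3 : ∀ l : ℕ, X k ω = flowFrom f V (k - l) l ω (X (k - l) ω) := fun l => by
      rw [← h2, sub_add_cancel]
    refine propext ⟨fun hx => ?_, fun hx => ?_⟩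
    · obtain ⟨l, hl⟩ := h1
      refine Set.mem_iUnion.2 ⟨l, fun y => ?_⟩
      rw [hl y, ← h3]
      exact hx
    · obtain ⟨l, hl⟩ := Set.mem_iUnion.1 hx
      exact (h3 l).trans (hl _)

lemma completedPast_state_le (huniv : SimultaneouslyAccordable μ f V Set.univ) (n : ℤ) :
    completedPast μ X n ≤ completedPast μ V n := by
  rintro s ⟨t, ht, hst⟩
  have : (⨆ k : Set.Iic n, MeasurableSpace.comap (X k) inferInstance) ≤ completedPast μ V n :=
    iSup_le fun k => measurable_iff_comap_le.1 (hc.measurable_state_completedPast huniv k.2)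
  obtain ⟨u, hu, htu⟩ := this t ht
  exact ⟨u, hu, hst.trans htu⟩

end IsRecursiveChain

end Coalescence

/-! ### Primitive matrices and uniqueness of the uniform evolution. -/

section Primitive

open scoped Matrix

variable {E : Type*} [Fintype E] [DecidableEq E] {P : Matrix E E ℝ}

lemma pow_add_apply_pos (hP : ∀ i j, 0 ≤ P i j) {a b : ℕ} {x y z : E}
    (h1 : 0 < (P ^ a) x y) (h2 : 0 < (P ^ b) y z) : 0 < (P ^ (a + b)) x z := by
  rw [pow_add, Matrix.mul_apply]
  exact Finset.sum_pos' (fun i _ => mul_nonneg (Matrix.pow_apply_nonneg hP a x i)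
    (Matrix.pow_apply_nonneg hP b i z)) ⟨y, Finset.mem_univ _, mul_pos h1 h2⟩

/-- Return times form an additive submonoid of `ℕ` with gcd `1`, which contains all large integers.
-/
lemma IsAperiodic.eventually_pow_apply_self_pos (hP : ∀ i j, 0 ≤ P i j) (h : IsAperiodic P)
    (x : E) : ∀ᶠ n in Filter.atTop, 0 < (P ^ n) x x := by
  let T : AddSubmonoid ℕ :=
    { carrier := {n | 0 < (P ^ n) x x}
      zero_mem' := by simp
      add_mem' := fun h1 h2 => pow_add_apply_pos hP h1 h2 }
  have hgcd : Nat.setGcd (T : Set ℕ) = 1 :=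
    h x _ fun n _ hn => Nat.setGcd_dvd_of_mem (s := (T : Set ℕ)) hn
  obtain ⟨n₀, hn₀⟩ := Nat.exists_mem_closure_of_ge (T : Set ℕ)
  filter_upwards [Filter.eventually_ge_atTop n₀] with n hn
  have := hn₀ n hn (by rw [hgcd]; exact one_dvd n)
  rwa [AddSubmonoid.closure_eq] at this

lemma isPrimitive_of_isIrreducible_of_isAperiodic (hirr : P.IsIrreducible) (h : IsAperiodic P) :
    P.IsPrimitive := by
  have hall : ∀ᶠ n in Filter.atTop, ∀ x y, 0 < (P ^ n) x y := by
    refine Filter.eventually_all.2 fun x => Filter.eventually_all.2 fun y => ?_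
    obtain ⟨k, -, hk⟩ := (Matrix.isIrreducible_iff_exists_pow_pos hirr.nonneg).1 hirr x y
    obtain ⟨n₀, hn₀⟩ := Filter.eventually_atTop.1 (h.eventually_pow_apply_self_pos hirr.nonneg y)
    filter_upwards [Filter.eventually_ge_atTop (k + n₀)] with n hn
    obtain ⟨c, rfl⟩ := Nat.exists_eq_add_of_le hn
    rw [add_assoc]
    exact pow_add_apply_pos hirr.nonneg hk (hn₀ _ (by lia))
  obtain ⟨k, hk, hk0⟩ := (hall.and (Filter.eventually_gt_atTop 0)).exists
  exact ⟨hirr.nonneg, k, hk0, hk⟩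

/-- For a primitive matrix whose columns sum to `1`, the only family of probability vectors
indexed by `ℤ` with `π (n + 1) = π n ᵥ* P` is the uniform one. -/
lemma eq_inv_card_of_isPrimitive [Nonempty E] (hP : P.IsPrimitive) (hcol : 1 ᵥ* P = 1)
    {π : ℤ → E → ℝ} (hπ : ∀ n, π (n + 1) = π n ᵥ* P) (h0 : ∀ n x, 0 ≤ π n x)
    (h1 : ∀ n, ∑ x, π n x = 1) (n : ℤ) (x : E) : π n x = (Fintype.card E : ℝ)⁻¹ := by
  obtain ⟨K, -, hK⟩ := hP.exists_pos_pow
  have hπK : ∀ (k : ℕ) n, π (n + k) = π n ᵥ* P ^ k := fun k n => by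
    induction k with
    | zero => simp
    | succ k ih => rw [Nat.cast_succ, ← add_assoc, hπ, ih, Matrix.vecMul_vecMul, pow_succ]
  have hcolK : ∀ k : ℕ, 1 ᵥ* P ^ k = 1 := fun k => by
    induction k with
    | zero => simp
    | succ k ih => rw [pow_succ, ← Matrix.vecMul_vecMul, ih, hcol]
  obtain ⟨⟨a, b⟩, hmin⟩ := Finite.exists_min fun p : E × E => (P ^ K) p.1 p.2
  -- Doeblin minorization: removing the smallest entry `δ` from `P ^ K` leaves a nonnegative matrix
  -- whose columns sum to `r < 1`.
  set δ := (P ^ K) a b with hδ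
  have hδ0 : 0 < δ := hK a b
  have hc : (0 : ℝ) < Fintype.card E := by exact_mod_cast Fintype.card_pos
  have hQ : ∀ y, ∑ x, (P ^ K) x y = 1 := fun y => by
    have := congrFun (hcolK K) y
    simpa [Matrix.vecMul, dotProduct] using this
  set r := 1 - Fintype.card E * δ with hr
  have hsumQ : ∀ y, ∑ x, ((P ^ K) x y - δ) = r := fun y => by
    simp [Finset.sum_sub_distrib, hQ, hr]
  have hr0 : 0 ≤ r := by
    rw [← hsumQ a]
    exact Finset.sum_nonneg fun x _ => sub_nonneg.2 (hmin (x, a))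
  have hr1 : r < 1 := by rw [hr]; linarith [mul_pos hc hδ0]
  have hd0 : ∀ n, ∑ x, (π n x - (Fintype.card E : ℝ)⁻¹) = 0 := fun n => by
    simp [Finset.sum_sub_distrib, h1, hc.ne']
  -- Subtracting `δ` is free because the deviations from uniform sum to zero.
  have hrec : ∀ n y, π (n + K) y - (Fintype.card E : ℝ)⁻¹ =
      ∑ x, (π n x - (Fintype.card E : ℝ)⁻¹) * ((P ^ K) x y - δ) := fun n y => by
    rw [hπK]
    simp only [mul_sub, sub_mul (π n _), Finset.sum_sub_distrib, ← Finset.mul_sum, hQ,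
      ← Finset.sum_mul, h1]
    simp [Matrix.vecMul, dotProduct]
  have hbound : ∀ (j : ℕ) n y, |π n y - (Fintype.card E : ℝ)⁻¹| ≤ r ^ j := by
    intro j
    induction j with
    | zero =>
      intro n y
      have h2 : π n y ≤ 1 := h1 n ▸ Finset.single_le_sum (fun x _ => h0 n x) (Finset.mem_univ y)
      have h3 : (Fintype.card E : ℝ)⁻¹ ≤ 1 :=
        inv_le_one_of_one_le₀ (by exact_mod_cast Fintype.card_pos)
      have h4 : 0 ≤ (Fintype.card E : ℝ)⁻¹ := by positivity
      rw [pow_zero, abs_le]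
      constructor <;> linarith [h0 n y]
    | succ j ih =>
      intro n y
      -- Indexing by `ℤ` permits going back `K` more steps, each time gaining a factor `r`.
      have := hrec (n - K) y
      rw [sub_add_cancel] at this
      rw [this, pow_succ]
      nth_rw 2 [← hsumQ y]
      rw [Finset.mul_sum]
      refine (Finset.abs_sum_le_sum_abs _ _).trans (Finset.sum_le_sum fun x _ => ?_)
      rw [abs_mul, abs_of_nonneg (sub_nonneg.2 (hmin (x, y)))]
      exact mul_le_mul_of_nonneg_right (ih _ _) (sub_nonneg.2 (hmin (x, y)))
  have := ge_of_tendsto' (tendsto_pow_atTop_nhds_zero_of_lt_one hr0 hr1) fun j => hbound j n x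
  exact sub_eq_zero.1 (abs_nonpos_iff.1 this)

end Primitive

/-! ### The bijective case: uniform law and independence from `V`. -/

section Uniform

variable {Ω E G : Type*} [MeasurableSpace Ω] [MeasurableSpace G]
  [Fintype E] [MeasurableSpace E] [MeasurableSingletonClass E]
  {μ : Measure Ω} {β : Measure G} {f : E × G → E} {X : ℤ → Ω → E} {V : ℤ → Ω → G}

lemma measure_eq_sum_inter_preimage {F : Type*} [Fintype F] {W : Ω → F}
    (hW : ∀ y, MeasurableSet (W ⁻¹' {y})) (A : Set Ω) : μ A = ∑ y, μ (A ∩ W ⁻¹' {y}) := by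
  have := sum_measure_preimage_singleton (μ := μ.restrict A) (f := W) Finset.univ
    fun y _ => hW y
  rw [Finset.coe_univ, Set.preimage_univ, Measure.restrict_apply_univ] at this
  rw [← this]
  exact Finset.sum_congr rfl fun y _ => by rw [Measure.restrict_apply (hW y), Set.inter_comm]

namespace IsRecursiveChain

variable (hc : IsRecursiveChain μ β f X V)
include hc

omit [Fintype E] in
lemma measurableSet_apply_eq (x y : E) : MeasurableSet {v | f (x, v) = y} :=
  (hc.measurable_map.comp (measurable_const.prodMk measurable_id)) (measurableSet_singleton y)

lemma measure_state_succ (n : ℤ) (y : E) :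
    μ (X (n + 1) ⁻¹' {y}) = ∑ x, μ (X n ⁻¹' {x}) * μ {ω | f (x, V 1 ω) = y} := by
  rw [measure_eq_sum_inter_preimage (W := X n)
    (fun x => hc.measurable_state n (measurableSet_singleton x))]
  refine Finset.sum_congr rfl fun x _ => ?_
  have h1 : μ {ω | f (x, V 1 ω) = y} = β {v | f (x, v) = y} := by
    rw [← hc.law_innovation 1, Measure.map_apply (hc.measurable_innovation 1)
      (hc.measurableSet_apply_eq x y)]
    rfl
  rw [h1, ← hc.measure_inter_innovation
    (measurable_state_past le_rfl (measurableSet_singleton x)) (hc.measurableSet_apply_eq x y)]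
  refine measure_congr ?_
  filter_upwards [hc.recursion n] with ω hω
  refine propext ⟨fun ⟨h2, h3⟩ => ⟨h3, ?_⟩, fun ⟨h2, h3⟩ => ⟨?_, h2⟩⟩
  · change f (x, V (n + 1) ω) = y
    rw [← show X n ω = x from h3, ← hω]; exact h2
  · change X (n + 1) ω = y
    rw [hω, show X n ω = x from h2]; exact h3

variable [IsProbabilityMeasure μ]

omit [IsProbabilityMeasure μ] in
lemma ae_bijective (hbij : ∀ h ∈ essentialMaps μ f V, Function.Bijective h) (n : ℤ) :
    ∀ᵐ ω ∂μ, Function.Bijective (stepMap f (V n ω)) := by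
  have := hc.ae_stepMap_mem
  rw [← hc.law_innovation n] at this
  filter_upwards [ae_of_ae_map (hc.measurable_innovation n).aemeasurable this] with ω hω
  exact hbij _ hω

/-- Almost surely exactly one state is sent to `y`, namely the value of `Y` below; its law has total
mass `1`. -/
lemma sum_measure_apply_eq (hbij : ∀ h ∈ essentialMaps μ f V, Function.Bijective h) (y : E) :
    ∑ x, μ {ω | f (x, V 1 ω) = y} = 1 := by
  have := nonempty_of_process μ X
  let Y : Ω → E := fun ω => Function.invFun (stepMap f (V 1 ω)) y
  have hY : Measurable Y :=
    (measurable_comp_stepMap hc.measurable_map fun h => Function.invFun h y).comp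
      (hc.measurable_innovation 1)
  have h1 : ∀ x, μ {ω | f (x, V 1 ω) = y} = μ (Y ⁻¹' {x}) := fun x => by
    refine measure_congr ?_
    filter_upwards [hc.ae_bijective hbij 1] with ω hω
    refine propext ⟨fun h => ?_, fun h => ?_⟩
    · change Function.invFun (stepMap f (V 1 ω)) y = x
      rw [← show stepMap f (V 1 ω) x = y from h]
      exact Function.leftInverse_invFun hω.1 x
    · change stepMap f (V 1 ω) x = y
      rw [← show Function.invFun (stepMap f (V 1 ω)) y = x from h]
      exact Function.rightInverse_invFun hω.2 y
  simp only [h1]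
  rw [sum_measure_preimage_singleton _ fun x _ => hY (measurableSet_singleton x)]
  simp

lemma measure_state_eq_inv_card [DecidableEq E]
    (hirr : (transitionMatrix μ f V).IsIrreducible)
    (haper : IsAperiodic (transitionMatrix μ f V))
    (hbij : ∀ h ∈ essentialMaps μ f V, Function.Bijective h) (n : ℤ) (x : E) :
    μ (X n ⁻¹' {x}) = (Fintype.card E : ℝ≥0∞)⁻¹ := by
  have := nonempty_of_process μ X
  have h := eq_inv_card_of_isPrimitive (isPrimitive_of_isIrreducible_of_isAperiodic hirr haper)
    (π := fun n x => μ.real (X n ⁻¹' {x})) ?_ ?_ (fun _ _ => measureReal_nonneg) ?_ n x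
  · rw [← ENNReal.ofReal_toReal (measure_ne_top μ (X n ⁻¹' {x}))]
    rw [measureReal_def] at h
    rw [h, ENNReal.ofReal_inv_of_pos (by exact_mod_cast Fintype.card_pos), ENNReal.ofReal_natCast]
  · funext y
    have := congrArg ENNReal.toReal (hc.sum_measure_apply_eq hbij y)
    rw [ENNReal.toReal_sum fun _ _ => measure_ne_top _ _] at this
    simpa [Matrix.vecMul, dotProduct, transitionMatrix, measureReal_def] using this
  · intro n
    funext y
    have := congrArg ENNReal.toReal (hc.measure_state_succ n y)
    rw [ENNReal.toReal_sum fun _ _ => ENNReal.mul_ne_top (measure_ne_top _ _)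
      (measure_ne_top _ _)] at this
    simpa [Matrix.vecMul, dotProduct, transitionMatrix, measureReal_def] using this
  · intro n
    have := congrArg ENNReal.toReal (sum_measure_preimage_singleton (μ := μ) (f := X n) Finset.univ
      fun x _ => hc.measurable_state n (measurableSet_singleton x))
    rw [ENNReal.toReal_sum fun _ _ => measure_ne_top _ _] at this
    simpa [measureReal_def] using this

omit [IsProbabilityMeasure μ] in
-- On the event that the new map is the bijection `g`, `X (n + 1) = x` means `X n = g⁻¹ x`. As `c`
-- does not depend on the state, it is unchanged.
lemma measure_state_succ_inter (hbij : ∀ h ∈ essentialMaps μ f V, Function.Bijective h)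
    {n : ℤ} {C : Set Ω} (hC : MeasurableSet[pastSigma X V n] C) {c : ℝ≥0∞}
    (h : ∀ x, μ (X n ⁻¹' {x} ∩ C) = c * μ C) {B : Set G} (hB : MeasurableSet B) (x : E) :
    μ (X (n + 1) ⁻¹' {x} ∩ (C ∩ V (n + 1) ⁻¹' B)) = c * μ (C ∩ V (n + 1) ⁻¹' B) := by
  have : Finite (Function.End E) := inferInstanceAs (Finite (E → E))
  cases nonempty_fintype (Function.End E)
  have hW : ∀ g : Function.End E,
      MeasurableSet ((fun ω => stepMap f (V (n + 1) ω)) ⁻¹' {g}) := fun g =>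
    hc.measurable_innovation _ (measurableSet_mapFiber hc.measurable_map g)
  rw [measure_eq_sum_inter_preimage hW (X (n + 1) ⁻¹' {x} ∩ _),
    measure_eq_sum_inter_preimage hW (C ∩ _), Finset.mul_sum]
  refine Finset.sum_congr rfl fun g _ => ?_
  have hBg : MeasurableSet (B ∩ mapFiber f g) :=
    hB.inter (measurableSet_mapFiber hc.measurable_map g)
  by_cases hg : g ∈ essentialMaps μ f V
  · obtain ⟨z, hz⟩ := (hbij g hg).2 x
    have h1 : C ∩ V (n + 1) ⁻¹' B ∩ (fun ω => stepMap f (V (n + 1) ω)) ⁻¹' {g} =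
        C ∩ V (n + 1) ⁻¹' (B ∩ mapFiber f g) := Set.inter_assoc _ _ _
    have h2 : μ (X (n + 1) ⁻¹' {x} ∩ (C ∩ V (n + 1) ⁻¹' B) ∩
        (fun ω => stepMap f (V (n + 1) ω)) ⁻¹' {g}) =
        μ (X n ⁻¹' {z} ∩ C ∩ V (n + 1) ⁻¹' (B ∩ mapFiber f g)) := by
      refine measure_congr ?_
      filter_upwards [hc.recursion n] with ω hω
      have key : stepMap f (V (n + 1) ω) = g → (X (n + 1) ω = x ↔ X n ω = z) := fun hs => by
        rw [hω, ← hz, ← hs]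
        refine ⟨fun h => (hbij g hg).1 ?_, fun h => by rw [h]; rfl⟩
        rw [← hs]; exact h
      refine propext ⟨fun ⟨⟨a, b, c⟩, d⟩ => ⟨⟨(key d).1 a, b⟩, c, d⟩,
        fun ⟨⟨a, b⟩, c, d⟩ => ⟨⟨(key d).2 a, b, c⟩, d⟩⟩
    rw [h1, h2, hc.measure_inter_innovation hC hBg, hc.measure_inter_innovation
      (MeasurableSet.inter (measurable_state_past le_rfl (measurableSet_singleton z)) hC) hBg,
      h z, mul_assoc]
  · have h0 : μ ((fun ω => stepMap f (V (n + 1) ω)) ⁻¹' {g}) = 0 := by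
      by_contra h0
      rw [hc.mem_essentialMaps_iff, ← hc.measure_map_eq (n + 1), pos_iff_ne_zero] at hg
      exact hg h0
    rw [measure_mono_null Set.inter_subset_right h0, measure_mono_null Set.inter_subset_right h0,
      mul_zero]

lemma measure_state_inter_box (hbij : ∀ h ∈ essentialMaps μ f V, Function.Bijective h)
    {c : ℝ≥0∞} (hX : ∀ n x, μ (X n ⁻¹' {x}) = c) {t : ℤ → Set G} (ht : ∀ k, MeasurableSet (t k))
    (m : ℤ) (l j : ℕ) (x : E) :
    μ (X (m + l) ⁻¹' {x} ∩ {ω | ∀ k, m < k → k ≤ m + (l + j : ℕ) → V k ω ∈ t k}) =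
      c * μ {ω | ∀ k, m < k → k ≤ m + (l + j : ℕ) → V k ω ∈ t k} := by
  have hsucc : ∀ i : ℕ, {ω | ∀ k, m < k → k ≤ m + (i + 1 : ℕ) → V k ω ∈ t k} =
      {ω | ∀ k, m < k → k ≤ m + (i : ℕ) → V k ω ∈ t k} ∩ V (m + i + 1) ⁻¹' t (m + i + 1) := by
    intro i
    ext ω
    simp only [Set.mem_ofPred_eq, Set.mem_inter_iff, Set.mem_preimage]
    refine ⟨fun h => ⟨fun k h1 h2 => h k h1 (by push_cast; lia),
      h _ (by lia) (by push_cast; lia)⟩, fun ⟨h, h'⟩ k h1 h2 => ?_⟩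
    rcases eq_or_ne k (m + i + 1) with rfl | hne
    · exact h'
    · exact h k h1 (by push_cast at h2; lia)
  have hmeas : ∀ i : ℕ, MeasurableSet[pastSigma X V (m + i)]
      {ω | ∀ k, m < k → k ≤ m + (i : ℕ) → V k ω ∈ t k} := by
    intro i
    have : {ω | ∀ k, m < k → k ≤ m + (i : ℕ) → V k ω ∈ t k} =
        ⋂ k ∈ Set.Ioc m (m + i), V k ⁻¹' t k := by
      ext ω; simp
    rw [this]
    exact MeasurableSet.biInter (Set.to_countable _) fun k hk =>
      measurable_innovation_past hk.2 (ht k)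
  -- `l` counts the innovations leading from time `m` to the state, `j` those after it. The former
  -- are handled by bijectivity, starting from an empty box; the latter are independent of the past.
  induction j with
  | zero =>
    rw [add_zero]
    induction l generalizing x with
    | zero =>
      have : {ω | ∀ k, m < k → k ≤ m + (0 : ℕ) → V k ω ∈ t k} = Set.univ := by
        ext ω
        simp only [Set.mem_ofPred_eq, Set.mem_univ, iff_true]
        intro k h1 h2; push_cast at h2; lia
      rw [this, Set.inter_univ, measure_univ, mul_one, hX]
    | succ l ih =>
      rw [hsucc, Nat.cast_succ, ← add_assoc]
      exact hc.measure_state_succ_inter hbij (hmeas l) ih (ht _) x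
  | succ j ih =>
    have hpast : MeasurableSet[pastSigma X V (m + (l + j : ℕ))] (X (m + l) ⁻¹' {x}) :=
      measurable_state_past (by push_cast; lia) (measurableSet_singleton x)
    rw [← add_assoc, hsucc, ← Set.inter_assoc,
      hc.measure_inter_innovation (hpast.inter (hmeas _)) (ht _), ih,
      hc.measure_inter_innovation (hmeas _) (ht _), mul_assoc]

lemma indepFun_state_innovations (hbij : ∀ h ∈ essentialMaps μ f V, Function.Bijective h)
    {c : ℝ≥0∞} (hX : ∀ n x, μ (X n ⁻¹' {x}) = c) (n : ℤ) :
    IndepFun (X n) (fun ω k => V k ω) μ := by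
  classical
  have hV : Measurable fun ω k => V k ω := measurable_pi_lambda _ hc.measurable_innovation
  rw [IndepFun_iff_Indep]
  refine IndepSets.indep (p1 := {s | MeasurableSet[MeasurableSpace.comap (X n) inferInstance] s})
    (p2 := {s | ∃ u ∈ squareCylinders (fun _ : ℤ => {s : Set G | MeasurableSet s}),
      (fun ω k => V k ω) ⁻¹' u = s})
    (hc.measurable_state n).comap_le hV.comap_le
    (@MeasurableSpace.isPiSystem_measurableSet Ω (MeasurableSpace.comap (X n) inferInstance))
    (IsPiSystem.comap (isPiSystem_squareCylinders
      (fun _ => MeasurableSpace.isPiSystem_measurableSet) fun _ => MeasurableSet.univ) _)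
    (@MeasurableSpace.generateFrom_measurableSet Ω
      (MeasurableSpace.comap (X n) inferInstance)).symm ?_ ?_
  · rw [← generateFrom_squareCylinders, MeasurableSpace.comap_generateFrom]
    rfl
  rw [IndepSets_iff]
  rintro _ _ ⟨A, hA, rfl⟩ ⟨_, ⟨I, t, ht, rfl⟩, rfl⟩
  -- Enclose the finite index set `I` in a window around `n`; coordinates of the window outside `I`
  -- are left unconstrained.
  obtain ⟨m, l, j, hml, hI⟩ : ∃ (m : ℤ) (l j : ℕ), n = m + l ∧
      ∀ k ∈ I, m < k ∧ k ≤ m + (l + j : ℕ) := by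
    obtain ⟨b, hb⟩ : ∃ b : ℕ, ∀ k ∈ I, |k - n| < b := by
      refine ⟨(∑ k ∈ I, |k - n| + 1).toNat, fun k hk => ?_⟩
      have := Finset.single_le_sum (fun i _ => abs_nonneg (i - n)) hk
      lia
    refine ⟨n - b, b, b, by ring, fun k hk => ?_⟩
    have := abs_lt.1 (hb k hk)
    push_cast
    constructor <;> lia
  have hbox : (fun ω k => V k ω) ⁻¹' (I : Set ℤ).pi t =
      {ω | ∀ k, m < k → k ≤ m + (l + j : ℕ) → V k ω ∈ if k ∈ I then t k else Set.univ} := by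
    ext ω
    simp only [Set.mem_preimage, Set.mem_pi, Finset.mem_coe, Set.mem_ofPred_eq]
    refine ⟨fun h k _ _ => ?_, fun h k hk => ?_⟩
    · split_ifs with hk
      · exact h k hk
      · trivial
    · have := h k (hI k hk).1 (hI k hk).2
      rwa [if_pos hk] at this
  have hkey : ∀ x, μ (X n ⁻¹' {x} ∩ (fun ω k => V k ω) ⁻¹' (I : Set ℤ).pi t) =
      c * μ ((fun ω k => V k ω) ⁻¹' (I : Set ℤ).pi t) := fun x => by
    rw [hbox, hml]
    refine hc.measure_state_inter_box hbij hX (fun k => ?_) m l j x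
    split_ifs
    · exact ht k trivial
    · exact MeasurableSet.univ
  have hfib : ∀ x ∈ A.toFinset, MeasurableSet (X n ⁻¹' {x}) := fun x _ =>
    hc.measurable_state n (measurableSet_singleton x)
  have h1 := sum_measure_preimage_singleton (μ := μ) (f := X n) A.toFinset hfib
  have h2 := sum_measure_preimage_singleton (f := X n)
    (μ := μ.restrict ((fun ω k => V k ω) ⁻¹' (I : Set ℤ).pi t)) A.toFinset hfib
  rw [Set.coe_toFinset] at h1 h2
  rw [Measure.restrict_apply (hc.measurable_state n hA)] at h2
  rw [← h1, ← h2, Finset.sum_mul]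
  refine Finset.sum_congr rfl fun x hx => ?_
  rw [Measure.restrict_apply (hfib x hx), hkey, hX]

omit [IsProbabilityMeasure μ] in
lemma map_state_eq_uniformOn (hX : ∀ n x, μ (X n ⁻¹' {x}) = (Fintype.card E : ℝ≥0∞)⁻¹) (n : ℤ) :
    μ.map (X n) = uniformOn Set.univ := by
  refine Measure.ext_of_singleton fun x => ?_
  rw [Measure.map_apply (hc.measurable_state n) (measurableSet_singleton x), hX, uniformOn_univ]
  simp

end IsRecursiveChain

end Uniform

end RecursiveChain

theorem mainTheorem4 {Ω E G : Type*} [MeasurableSpace Ω] [MeasurableSpace G]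
    [Fintype E] [DecidableEq E] [MeasurableSpace E] [MeasurableSingletonClass E]
    (μ : Measure Ω) [IsProbabilityMeasure μ] (β : Measure G) (f : E × G → E)
    (X : ℤ → Ω → E) (V : ℤ → Ω → G)
    (hchain : RecursiveChain.IsRecursiveChain μ β f X V)
    (hirr : (RecursiveChain.transitionMatrix μ f V).IsIrreducible)
    (haper : RecursiveChain.IsAperiodic (RecursiveChain.transitionMatrix μ f V))
    (hH : RecursiveChain.UniformInvariantForEquivalentLaw β f) :
    (∀ s ∈ RecursiveChain.mapSemigroup μ f V, RecursiveChain.RealizesMaximalAccord μ f V s →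
      ∀ y ∈ Set.range s,
        (s ⁻¹' {y}).ncard = RecursiveChain.maxAccordable μ f V ∧
          RecursiveChain.SimultaneouslyAccordable μ f V (s ⁻¹' {y})) ∧
    RecursiveChain.maxNonaccordable μ f V * RecursiveChain.maxAccordable μ f V
      = Fintype.card E ∧
    ((Fintype.card E).Prime →
      Xor
        ((∀ h ∈ RecursiveChain.essentialMaps μ f V, Function.Bijective h) ∧
          ∀ n : ℤ, μ.map (X n) = uniformOn Set.univ ∧ IndepFun (X n) (fun ω k => V k ω) μ)
        (RecursiveChain.SimultaneouslyAccordable μ f V Set.univ ∧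
          ∀ n : ℤ, RecursiveChain.completedPast μ X n ≤ RecursiveChain.completedPast μ V n)) := by
  have hmul := hchain.maxNonaccordable_mul_maxAccordable hH hirr
  refine ⟨fun s hs hmax y hy => ⟨hchain.ncard_fiber hH hirr hs hmax.2 hy,
    RecursiveChain.simultaneouslyAccordable_fiber hs y⟩, hmul, fun hprime => ?_⟩
  -- `N` divides the prime `Card E`. The two cases exclude each other because `Card E > 1`: a map of
  -- `S` cannot be both bijective and constant.
  rcases (Nat.dvd_prime hprime).1 (Dvd.intro_left _ hmul) with hN | hN
  · have hbij : ∀ h ∈ RecursiveChain.mapSemigroup μ f V, Function.Bijective h :=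
      fun h hh => RecursiveChain.bijective_of_maxAccordable_eq_one hN hh
    have hbijH : ∀ h ∈ RecursiveChain.essentialMaps μ f V, Function.Bijective h :=
      fun h hh => hbij h (Subsemigroup.subset_closure hh)
    have hX := hchain.measure_state_eq_inv_card hirr haper hbijH
    refine Or.inl ⟨⟨hbijH, fun n => ⟨hchain.map_state_eq_uniformOn hX n,
      hchain.indepFun_state_innovations hbijH hX n⟩⟩, fun h => ?_⟩
    have := h.1.ncard_le
    rw [Set.ncard_univ, Nat.card_eq_fintype_card, hN] at this
    exact absurd hprime.one_lt this.not_gt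
  · have huniv := hchain.simultaneouslyAccordable_univ hN
    refine Or.inr ⟨⟨huniv, hchain.completedPast_state_le huniv⟩, fun h => ?_⟩
    have : Nontrivial E := Fintype.one_lt_card_iff_nontrivial.1 hprime.one_lt
    obtain ⟨x, y, hxy⟩ := exists_pair_ne E
    obtain ⟨s, hs, hconst⟩ := huniv
    have hsbij := RecursiveChain.bijective_of_forall_essentialMaps h.1 hs
    exact hxy (hsbij.1 (hconst x trivial y trivial))
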